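/- Let $M$ be a matroid on a finite ground set, with circuit set $\mathcal{C}(M)$, rank function $r$ and nullity $\eta(S)=|S|-r(S)$. For a collection $\mathcal{E}$ of subsets of $\mathcal{C}(M)$ put $$\epsilon(\mathcal{E})=\mathcal{E}\cup\{(A_1\cup A_2)\setminus\{C\} : A_1,A_2\in\mathcal{E},\ A_1\cap A_2\notin\mathcal{E},\ C\in A_1\cap A_2\},$$ $${\uparrow}\mathcal{E}=\{A\subseteq\mathcal{C}(M) : A'\subseteq A \text{ for some } A'\in\mathcal{E}\}.$$ Let $\mathcal{A}_0=\{A\subseteq\mathcal{C}(M) : |A|>\eta(\bigcup_{C\in A}C)\}$, $\mathcal{A}_{i+1}={\uparrow}\epsilon(\mathcal{A}_i)$ for $i\ge 0$, and $\mathcal{A}=\bigcup_{i\ge 0}\mathcal{A}_i$. The combinatorial derived matroid $\delta M$ is the matroid on the ground set $\mathcal{C}(M)$ whose dependent sets are the elements of $\mathcal{A}$. Let $U^2_4$ denote the uniform matroid of rank $2$ on $4$ elements. **Theorem.** If $M$ is a matroid on a finite ground set with $\delta M\cong M$, then $M$ is a direct sum of finitely many (possibly zero) matroids, each of which is isomorphic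 to $U^2_4$. Moreover, $\delta U^2_4\cong U^2_4$, and the circuits of $U^2_4$ are exactly the $3$-element subsets of its ground set, that is, its circuit hypergraph is the complete $3$-regular hypergraph $K^3_4$. -/

import Mathlib

namespace DerivedMatroid

/-- The collection obtained from `𝓔` by adding all sets `(A₁ ∪ A₂) \ {v}` with `A₁, A₂ ∈ 𝓔`,
`A₁ ∩ A₂ ∉ 𝓔` and `v ∈ A₁ ∩ A₂`. -/
def eps {β : Type*} (𝓔 : Set (Set β)) : Set (Set β) :=
  𝓔 ∪ {B | ∃ A₁ ∈ 𝓔, ∃ A₂ ∈ 𝓔, A₁ ∩ A₂ ∉ 𝓔 ∧ ∃ v ∈ A₁ ∩ A₂, B = (A₁ ∪ A₂) \ {v}}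

/-- The upward closure of `𝓔` among the subsets of the ground set `V`. -/
def up {β : Type*} (V : Set β) (𝓔 : Set (Set β)) : Set (Set β) :=
  {A | A ⊆ V ∧ ∃ A' ∈ 𝓔, A' ⊆ A}

/-- The nullity `|S| - r(S)` of a set in a matroid. -/
noncomputable def nullity {α : Type*} (M : Matroid α) (S : Set α) : ℕ∞ :=
  S.encard - M.eRk S

/-- The circuit set of a matroid. -/
def circuits {α : Type*} (M : Matroid α) : Set (Set α) := {C | M.IsCircuit C}

/-- `𝓐₀` consists of the sets `A` of circuits with `|A| > η(⋃ A)`, and `𝓐ᵢ₊₁ = ↑ε(𝓐ᵢ)`. -/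
def family {α : Type*} (M : Matroid α) : ℕ → Set (Set (Set α))
  | 0 => {A | A ⊆ circuits M ∧ nullity M (⋃₀ A) < A.encard}
  | i + 1 => up (circuits M) (eps (family M i))

/-- The union `𝓐` of all the `𝓐ᵢ`. -/
def depFamily {α : Type*} (M : Matroid α) : Set (Set (Set α)) := ⋃ i, family M i

/-- Augmentation for the complement of a collection of sets that satisfies the axioms for the
dependent sets of a matroid. -/
theorem aug_of_dep {β : Type*} {E : Set β} (hE : E.Finite) {D : Set (Set β)}
    (hup : ∀ ⦃A B⦄, A ∈ D → A ⊆ B → B ⊆ E → B ∈ D)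
    (helim : ∀ ⦃A B⦄, A ∈ D → B ∈ D → A ∩ B ∉ D → ∀ v ∈ A ∩ B, (A ∪ B) \ {v} ∈ D)
    {I J : Set β} (hI : I ⊆ E ∧ I ∉ D) (hJ : J ⊆ E ∧ J ∉ D) (hIJ : I.ncard < J.ncard) :
    ∃ e ∈ J, e ∉ I ∧ (insert e I ⊆ E ∧ insert e I ∉ D) := by
  classical
  by_contra hcon
  push Not at hcon
  have hex : ∃ n : ℕ, ∃ K, K ⊆ I ∪ J ∧ K ∉ D ∧ I.ncard < K.ncard ∧ (I \ K).ncard = n :=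
    ⟨_, J, Set.subset_union_right, hJ.2, hIJ, rfl⟩
  obtain ⟨K, hKs, hKD, hKc, hKn⟩ := Nat.find_spec hex
  have hmin : ∀ T, T ⊆ I ∪ J → I.ncard < T.ncard → (I \ T).ncard < (I \ K).ncard → T ∈ D := by
    intro T hT hTc hlt
    by_contra hTD
    exact Nat.find_min hex (hKn ▸ hlt) ⟨T, hT, hTD, hTc, rfl⟩
  have hIJE : I ∪ J ⊆ E := Set.union_subset hI.1 hJ.1
  have hKE : K ⊆ E := hKs.trans hIJE
  have hKf : K.Finite := hE.subset hKE
  have hIf : I.Finite := hE.subset hI.1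
  obtain ⟨g, hgK, hgI⟩ : ∃ g ∈ K, g ∉ I := Set.exists_mem_notMem_of_ncard_lt_ncard hKc hIf
  obtain ⟨e, heI, heK⟩ : ∃ e ∈ I, e ∉ K := by
    by_contra hno
    push Not at hno
    have hgJ : g ∈ J := (hKs hgK).resolve_left hgI
    have hins : insert g I ⊆ E := Set.insert_subset (hKE hgK) hI.1
    have := hcon g hgJ hgI hins
    exact hKD (hup this (Set.insert_subset hgK hno) hKE)
  have hT : ∀ f ∈ K, f ∉ I → insert e K \ {f} ∈ D := by
    intro f hfK hfI
    have hef : e ≠ f := fun h => hfI (h ▸ heI)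
    apply hmin
    · exact Set.sdiff_subset.trans (Set.insert_subset (Or.inl heI) hKs)
    · rw [Set.ncard_sdiff_singleton_of_mem (Set.mem_insert_of_mem _ hfK),
        Set.ncard_insert_of_notMem heK hKf]
      simpa using hKc
    · apply Set.ncard_lt_ncard _ (hIf.subset Set.sdiff_subset)
      refine ⟨?_, fun h => ?_⟩
      · rintro x ⟨hxI, hx⟩
        refine ⟨hxI, fun hxK => hx ⟨Or.inr hxK, ?_⟩⟩
        rintro rfl
        exact hfI hxI
      · exact (h ⟨heI, heK⟩).2 ⟨Or.inl rfl, hef⟩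
  have heE : insert e K ⊆ E := Set.insert_subset (hI.1 heI) hKE
  have key : ∀ F : Set β, F.Finite → F ⊆ K \ I → insert e K \ F ∈ D := by
    intro F hF
    induction F, hF using Set.Finite.induction_on with
    | empty =>
      intro _
      rw [Set.sdiff_empty]
      exact hup (hT g hgK hgI) Set.sdiff_subset heE
    | @insert h F hhF _ ih =>
      intro hsub
      have hh : h ∈ K \ I := hsub (Set.mem_insert _ _)
      have hFs : F ⊆ K \ I := (Set.subset_insert _ _).trans hsub
      have h1 := ih hFs
      have h2 := hT h hh.1 hh.2
      have hint : (insert e K \ F) ∩ (insert e K \ {h}) = insert e K \ insert h F := by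
        ext x
        simp only [Set.mem_inter_iff, Set.mem_sdiff, Set.mem_insert_iff, Set.mem_singleton_iff]
        tauto
      by_contra hn
      rw [← hint] at hn
      have heF : e ∉ F := fun h => heK (hFs h).1
      have heh : e ≠ h := fun h' => heK (h' ▸ hh.1)
      have h3 := helim h1 h2 hn e ⟨⟨Or.inl rfl, heF⟩, Or.inl rfl, heh⟩
      refine hKD (hup h3 ?_ hKE)
      rintro x ⟨hx | hx, hxe⟩
      · exact hx.1.resolve_left hxe
      · exact hx.1.resolve_left hxe
  refine hI.2 (hup (key (K \ I) (hKf.subset Set.sdiff_subset) subset_rfl) ?_ hI.1)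
  rintro x ⟨hx | hx, hxn⟩
  · exact hx ▸ heI
  · by_contra hxI
    exact hxn ⟨hx, hxI⟩

theorem family_subset {α : Type*} (M : Matroid α) (i : ℕ) {A : Set (Set α)}
    (hA : A ∈ family M i) : A ⊆ circuits M := by
  cases i with
  | zero => exact hA.1
  | succ i => exact hA.1

theorem family_mono {α : Type*} (M : Matroid α) : Monotone (family M) :=
  monotone_nat_of_le_succ fun i A hA => ⟨family_subset M i hA, A, Or.inl hA, subset_rfl⟩

theorem family_nonempty {α : Type*} (M : Matroid α) (i : ℕ) : ∅ ∉ family M i := by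
  induction i with
  | zero => simp [family]
  | succ i ih =>
    rintro ⟨-, A, hA, hA0⟩
    obtain rfl := Set.subset_empty_iff.1 hA0
    rcases hA with hA | ⟨A₁, h₁, A₂, h₂, hn, v, hv, h⟩
    · exact ih hA
    · have hs : A₁ ∪ A₂ ⊆ {v} := Set.sdiff_eq_empty.1 h.symm
      have e₁ : A₁ = {v} := (Set.subset_union_left.trans hs).antisymm (by simpa using hv.1)
      have e₂ : A₂ = {v} := (Set.subset_union_right.trans hs).antisymm (by simpa using hv.2)
      subst e₁ e₂
      exact hn (by simpa using h₁)

theorem depFamily_up {α : Type*} (M : Matroid α) ⦃A B : Set (Set α)⦄ (hA : A ∈ depFamily M)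
    (hAB : A ⊆ B) (hB : B ⊆ circuits M) : B ∈ depFamily M := by
  obtain ⟨i, hi⟩ := Set.mem_iUnion.1 hA
  exact Set.mem_iUnion.2 ⟨i + 1, hB, A, Or.inl hi, hAB⟩

theorem depFamily_elim {α : Type*} (M : Matroid α) ⦃A B : Set (Set α)⦄ (hA : A ∈ depFamily M)
    (hB : B ∈ depFamily M) (hn : A ∩ B ∉ depFamily M) (v : Set α) (hv : v ∈ A ∩ B) :
    (A ∪ B) \ {v} ∈ depFamily M := by
  obtain ⟨i, hi⟩ := Set.mem_iUnion.1 hA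
  obtain ⟨j, hj⟩ := Set.mem_iUnion.1 hB
  have hi' := family_mono M (le_max_left i j) hi
  have hj' := family_mono M (le_max_right i j) hj
  refine Set.mem_iUnion.2 ⟨max i j + 1, ?_, _, Or.inr ⟨A, hi', B, hj', ?_, v, hv, rfl⟩, subset_rfl⟩
  · exact Set.sdiff_subset.trans
      (Set.union_subset (family_subset M _ hi') (family_subset M _ hj'))
  · exact fun h => hn (Set.mem_iUnion.2 ⟨_, h⟩)

theorem circuits_finite {α : Type*} (M : Matroid α) [M.Finite] : (circuits M).Finite :=
  M.ground_finite.finite_subsets.subset fun _ hC => hC.subset_ground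

/-- The combinatorial derived matroid `δM` of a finite matroid `M`: its ground set is the set of
circuits of `M`, and its dependent sets are the members of `𝓐` (see `derived_dep_iff`). -/
noncomputable def derived {α : Type*} (M : Matroid α) [M.Finite] : Matroid (Set α) :=
  (IndepMatroid.ofFinite (circuits_finite M) (fun A => A ⊆ circuits M ∧ A ∉ depFamily M)
    ⟨Set.empty_subset _, fun h => by
      obtain ⟨i, hi⟩ := Set.mem_iUnion.1 h
      exact family_nonempty M i hi⟩
    (fun _ _ hJ hIJ => ⟨hIJ.trans hJ.1, fun h => hJ.2 (depFamily_up M h hIJ hJ.1)⟩)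
    (fun _ _ hI hJ h =>
      aug_of_dep (circuits_finite M) (depFamily_up M) (depFamily_elim M) hI hJ h)
    (fun _ hI => hI.1)).matroid

theorem derived_ground {α : Type*} (M : Matroid α) [M.Finite] :
    (derived M).E = circuits M := rfl

theorem derived_dep_iff {α : Type*} (M : Matroid α) [M.Finite] (A : Set (Set α)) :
    (derived M).Dep A ↔ A ∈ depFamily M := by
  have h : A ∈ depFamily M → A ⊆ circuits M := fun h => by
    obtain ⟨i, hi⟩ := Set.mem_iUnion.1 h
    exact family_subset M i hi
  change ¬ (A ⊆ circuits M ∧ A ∉ depFamily M) ∧ A ⊆ circuits M ↔ _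
  tauto

/-- The uniform matroid of rank `min r n` on the `n`-element set `Fin n`: a set is independent
if and only if it has at most `r` elements. -/
noncomputable def uniform (r n : ℕ) : Matroid (Fin n) :=
  (IndepMatroid.ofFinite (Set.finite_univ (α := Fin n)) (fun I => I.ncard ≤ r)
    (by simp)
    (fun _ J hJ hIJ => (Set.ncard_le_ncard hIJ J.toFinite).trans hJ)
    (fun I J _ hJ h => by
      obtain ⟨e, he, heI⟩ := Set.exists_mem_notMem_of_ncard_lt_ncard h I.toFinite
      refine ⟨e, he, heI, ?_⟩
      rw [Set.ncard_insert_of_notMem heI I.toFinite]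
      omega)
    (fun _ _ => Set.subset_univ _)).matroid

/-- Two matroids are isomorphic if there is a bijection of their ground sets that preserves
independence in both directions. -/
def Isomorphic {α β : Type*} (M : Matroid α) (N : Matroid β) : Prop :=
  ∃ e : M.E ≃ N.E, ∀ I : Set M.E,
    M.Indep (Subtype.val '' I) ↔ N.Indep (Subtype.val '' (e '' I))

/-- `M` is the direct sum of finitely many (possibly zero) matroids with pairwise disjoint
ground sets, each of which is isomorphic to `N`. -/
def IsDirectSumOfCopies {α β : Type*} (M : Matroid α) (N : Matroid β) : Prop :=
  ∃ (k : ℕ) (P : Fin k → Matroid α)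
    (h : Pairwise fun i j => Disjoint (P i).E (P j).E),
    M = Matroid.disjointSigma P h ∧ ∀ i, Isomorphic (P i) N

end DerivedMatroid

/-!
An isomorphism `M ≅ δM` assigns to every element of `M` a circuit of `M`. No dependent set of `δM`
has fewer than three elements, so `M` is simple. Circuits of `M` inside a common component of `M`
lie in a common component of `δM`; as there are finitely many components, the isomorphism therefore
induces a permutation `τ` of the components of `M` such that the elements of `K` correspond to the
circuits contained in `τ K`.

More than `η(τ K)` circuits contained in `τ K` are dependent in `δM`, whence `r(K) ≤ η(τ K)`. An ear
decomposition shows that a connected set of nullity `c` contains at least `c(c + 1)/2` circuits.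
Since `τ K` contains `r(K) + η(K)` circuits, comparing the sums of the nullities over all components
forces `r(K) = η(K) = η(τ K) = c` with `2 ≤ c` and `c(c + 1) ≤ 4c`, that is, `c ≤ 3`. A connected
simple matroid with six elements and rank three has at least seven circuits rather than six, so
`c = 2`, and `K` carries a simple matroid of rank two on four elements, which is `U²₄`.
-/

namespace DerivedMatroid

open Set

variable {α : Type*} {M : Matroid α}

/-- The rank of a set as a natural number; it carries information only where `M.eRk S` is finite. -/
noncomputable def rk (M : Matroid α) (S : Set α) : ℕ := (M.eRk S).toNat

/-- The nullity of a set as a natural number, so that it can be used in arithmetic; it carries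
information only where `nullity M S` is finite, in particular for finite `S`. -/
noncomputable def nul (M : Matroid α) (S : Set α) : ℕ := (nullity M S).toNat

section Nullity

variable {S T C D I : Set α} {x : α}

theorem cast_rk (hS : S.Finite) : (rk M S : ℕ∞) = M.eRk S :=
  ENat.natCast_toNat (ne_top_of_le_ne_top hS.encard_lt_top.ne (M.eRk_le_encard S))

theorem cast_nul (hS : S.Finite) : (nul M S : ℕ∞) = nullity M S :=
  ENat.natCast_toNat (ne_top_of_le_ne_top hS.encard_lt_top.ne tsub_le_self)

theorem rk_add_nul (hS : S.Finite) : rk M S + nul M S = S.ncard := by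
  have h : M.eRk S + nullity M S = S.encard := add_tsub_cancel_of_le (M.eRk_le_encard S)
  rw [← cast_rk hS, ← cast_nul hS, ← hS.cast_ncard_eq] at h
  exact_mod_cast h

theorem ncard_le_rk_of_indep (hI : M.Indep I) (hIS : I ⊆ S) (hS : S.Finite) :
    I.ncard ≤ rk M S := by
  have h := hI.encard_le_eRk_of_subset hIS
  rw [← cast_rk hS, ← (hS.subset hIS).cast_ncard_eq] at h
  exact_mod_cast h

theorem exists_indep_ncard_eq_rk (M : Matroid α) (hS : S.Finite) :
    ∃ I ⊆ S, M.Indep I ∧ I.ncard = rk M S := by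
  obtain ⟨I, hI⟩ := M.exists_isBasis' S
  have h := hI.encard_eq_eRk
  rw [← cast_rk hS, ← (hS.subset hI.subset).cast_ncard_eq] at h
  exact ⟨I, hI.subset, hI.indep, mod_cast h⟩

theorem rk_le_of_forall_indep {n : ℕ} (hS : S.Finite)
    (h : ∀ I ⊆ S, M.Indep I → I.ncard ≤ n) : rk M S ≤ n := by
  obtain ⟨I, hIS, hI, hcard⟩ := exists_indep_ncard_eq_rk M hS
  exact hcard ▸ h I hIS hI

theorem nul_mono (hST : S ⊆ T) (hT : T.Finite) : nul M S ≤ nul M T := by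
  have hrk : M.eRk T ≤ M.eRk S + (T \ S).encard := by
    simpa only [union_sdiff_cancel hST] using M.eRk_union_le_eRk_add_encard S (T \ S)
  rw [← cast_rk hT, ← cast_rk (hT.subset hST), ← hT.sdiff.cast_ncard_eq] at hrk
  have hrk' : rk M T ≤ rk M S + (T \ S).ncard := mod_cast hrk
  have hcard := ncard_sdiff_add_ncard_of_subset hST hT
  have hS := rk_add_nul (M := M) (hT.subset hST)
  have hT := rk_add_nul (M := M) hT
  lia

theorem nul_sdiff_singleton_add_one (hC : M.IsCircuit C) (hCT : C ⊆ T) (hx : x ∈ C)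
    (hT : T.Finite) : nul M (T \ {x}) + 1 = nul M T := by
  have hcl : x ∈ M.closure (T \ {x}) :=
    M.closure_subset_closure (sdiff_subset_sdiff_left hCT)
      (hC.mem_closure_sdiff_singleton_of_mem hx)
  have hrk : rk M (T \ {x}) = rk M T := by
    rw [rk, rk, ← M.eRk_closure_eq (T \ {x}), ← M.closure_insert_eq_of_mem_closure hcl,
      insert_sdiff_singleton, insert_eq_of_mem (hCT hx), M.eRk_closure_eq]
  have hcard := ncard_sdiff_singleton_add_one (hCT hx) hT
  have hsdiff := rk_add_nul (M := M) (hT.sdiff (t := {x}))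
  have hT := rk_add_nul (M := M) hT
  lia

theorem nul_eq_of_forall_isCircuit_subset (hST : S ⊆ T) (hT : T.Finite) (hTE : T \ S ⊆ M.E)
    (h : ∀ C, M.IsCircuit C → C ⊆ T → C ⊆ S) : nul M S = nul M T := by
  obtain ⟨I, hIS, hI, hIrk⟩ := exists_indep_ncard_eq_rk M (hT.subset hST)
  have hIT : I ∪ (T \ S) ⊆ T := union_subset (hIS.trans hST) sdiff_subset
  have hindep : M.Indep (I ∪ (T \ S)) := by
    rw [Matroid.indep_iff_forall_subset_not_isCircuit (union_subset hI.subset_ground hTE)]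
    intro C hCI hC
    have hCS := h C hC (hCI.trans hIT)
    exact hC.not_indep (hI.subset fun x hx => (hCI hx).resolve_right fun h' => h'.2 (hCS hx))
  have hle := ncard_le_rk_of_indep hindep hIT hT
  rw [ncard_union_eq (disjoint_sdiff_right.mono_left hIS) (hT.subset (hIS.trans hST)) hT.sdiff]
    at hle
  have hmono := nul_mono (M := M) hST hT
  have hcard := ncard_sdiff_add_ncard_of_subset hST hT
  have hS := rk_add_nul (M := M) (hT.subset hST)
  have hT := rk_add_nul (M := M) hT
  lia

theorem nul_eq_zero_of_indep (hI : M.Indep I) : nul M I = 0 := by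
  simp only [nul, nullity, hI.eRk_eq_encard, tsub_self, ENat.toNat_zero]

theorem nul_eq_one_of_isCircuit [M.Finitary] (hC : M.IsCircuit C) : nul M C = 1 := by
  obtain ⟨x, hx⟩ := hC.nonempty
  rw [← nul_sdiff_singleton_add_one hC subset_rfl hx hC.finite,
    nul_eq_zero_of_indep (hC.sdiff_singleton_indep hx)]

theorem nul_eq_zero_iff_indep (hS : S.Finite) : nul M S = 0 ↔ M.Indep S := by
  refine ⟨fun h => ?_, nul_eq_zero_of_indep⟩
  obtain ⟨I, hIS, hI, hIrk⟩ := exists_indep_ncard_eq_rk M hS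
  have hrk := rk_add_nul (M := M) hS
  rwa [← eq_of_subset_of_ncard_le hIS (by lia) hS]

theorem two_le_nul_of_ne_of_subset (hC : M.IsCircuit C) (hD : M.IsCircuit D) (hne : C ≠ D)
    (hCT : C ⊆ T) (hDT : D ⊆ T) (hT : T.Finite) : 2 ≤ nul M T := by
  obtain ⟨x, hxC, hxD⟩ : ∃ x ∈ C, x ∉ D :=
    not_subset.1 fun h => hne (hC.eq_of_subset_isCircuit hD h)
  have hpos : nul M (T \ {x}) ≠ 0 := fun h => hD.not_indep <|
    ((nul_eq_zero_iff_indep hT.sdiff).1 h).subset (subset_sdiff_singleton hDT hxD)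
  rw [← nul_sdiff_singleton_add_one hC hCT hxC hT]
  lia

theorem exists_isCircuit_ne_of_two_le_nul (hT : T.Finite) (hTE : T ⊆ M.E)
    (h : 2 ≤ nul M T) :
    ∃ C D, M.IsCircuit C ∧ M.IsCircuit D ∧ C ≠ D ∧ C ⊆ T ∧ D ⊆ T := by
  have exists_isCircuit {S : Set α} (hST : S ⊆ T) (hS : nul M S ≠ 0) :
      ∃ C ⊆ S, M.IsCircuit C :=
    (Matroid.not_indep_iff (hST.trans hTE)).1
      (mt nul_eq_zero_of_indep hS) |>.exists_isCircuit_subset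
  obtain ⟨C, hCT, hC⟩ := exists_isCircuit subset_rfl (by lia)
  obtain ⟨x, hx⟩ := hC.nonempty
  have hsdiff := nul_sdiff_singleton_add_one hC hCT hx hT
  obtain ⟨D, hDT, hD⟩ := exists_isCircuit (S := T \ {x}) sdiff_subset (by lia)
  exact ⟨C, D, hC, hD, fun h => (hDT (h ▸ hx)).2 rfl, hCT, hDT.trans sdiff_subset⟩

end Nullity

/-- Two elements are linked in `S` if they are equal or lie in a common circuit contained in `S`;
by `Linked.trans` this is an equivalence relation, whose classes for `S = M.E` are the connected
components of `M`. -/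
def Linked (M : Matroid α) (S : Set α) (e f : α) : Prop :=
  e = f ∨ ∃ C, M.IsCircuit C ∧ C ⊆ S ∧ e ∈ C ∧ f ∈ C

/-- A set of elements of `M` is connected if any two of its elements are linked in it. -/
structure IsConnSet (M : Matroid α) (S : Set α) : Prop where
  subset_ground : S ⊆ M.E
  linked : ∀ e ∈ S, ∀ f ∈ S, Linked M S e f

/-- The circuits of `M` contained in `S`, that is, the circuits of the restriction `M ↾ S`. -/
def circuitsIn (M : Matroid α) (S : Set α) : Set (Set α) := {C | M.IsCircuit C ∧ C ⊆ S}

section Linked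

variable {S T C D : Set α} {e f g : α}

theorem exists_isCircuit_subset_union [M.Finitary] (hC : M.IsCircuit C) (hD : M.IsCircuit D)
    (hCD : (C ∩ D).Nonempty) (he : e ∈ C) (hg : g ∈ D) :
    ∃ F ⊆ C ∪ D, M.IsCircuit F ∧ e ∈ F ∧ g ∈ F := by
  induction hn : (C ∪ D).ncard using Nat.strong_induction_on generalizing C D with
  | _ n ih =>
  have of_ssubset {C' D' : Set α} (hss : C' ∪ D' ⊂ C ∪ D) (hC' : M.IsCircuit C')
      (hD' : M.IsCircuit D') (hCD' : (C' ∩ D').Nonempty) (he' : e ∈ C') (hg' : g ∈ D') :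
      ∃ F ⊆ C ∪ D, M.IsCircuit F ∧ e ∈ F ∧ g ∈ F := by
    obtain ⟨F, hF, hFcirc, heF, hgF⟩ :=
      ih _ (hn ▸ ncard_lt_ncard hss (hC.finite.union hD.finite)) hC' hD' hCD' he' hg' rfl
    exact ⟨F, hF.trans hss.subset, hFcirc, heF, hgF⟩
  by_cases heD : e ∈ D
  · exact ⟨D, subset_union_right, hD, heD, hg⟩
  by_cases hgC : g ∈ C
  · exact ⟨C, subset_union_left, hC, he, hgC⟩
  obtain ⟨x, hxC, hxD⟩ := hCD
  obtain ⟨C', hC'sub, hC', heC'⟩ := hC.strong_elimination hD hxC hxD he heD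
  obtain ⟨D', hD'sub, hD', hgD'⟩ := hD.strong_elimination hC hxD hxC hg hgC
  rw [union_comm D C] at hD'sub
  obtain ⟨y, hyC', hyC⟩ : ∃ y ∈ C', y ∉ C := not_subset.1 fun h =>
    (hC'sub (hC'.eq_of_subset_isCircuit hC h ▸ hxC)).2 rfl
  obtain ⟨z, hzD', hzD⟩ : ∃ z ∈ D', z ∉ D := not_subset.1 fun h =>
    (hD'sub (hD'.eq_of_subset_isCircuit hD h ▸ hxD)).2 rfl
  have hyD : y ∈ D := (hC'sub hyC').1.resolve_left hyC
  have hzC : z ∈ C := (hD'sub hzD').1.resolve_right hzD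
  by_cases hyD' : y ∈ D'
  · have hsub : C' ∪ D' ⊆ (C ∪ D) \ {x} := union_subset hC'sub hD'sub
    have hss : C' ∪ D' ⊂ C ∪ D := hsub.trans_ssubset (sdiff_singleton_ssubset.2 (.inl hxC))
    exact of_ssubset hss hC' hD' ⟨y, hyC', hyD'⟩ heC' hgD'
  · have hss : C ∪ D' ⊂ C ∪ D := by
      refine (ssubset_iff_of_subset ?_).2 ⟨y, .inr hyD, fun h => h.elim hyC hyD'⟩
      exact union_subset subset_union_left (hD'sub.trans sdiff_subset)
    exact of_ssubset hss hC hD' ⟨z, hzC, hzD'⟩ he hgD'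

theorem Linked.refl (M : Matroid α) (S : Set α) (e : α) : Linked M S e e := .inl rfl

theorem Linked.symm (h : Linked M S e f) : Linked M S f e := by
  rcases h with rfl | ⟨C, hC, hCS, he, hf⟩
  · exact .inl rfl
  · exact .inr ⟨C, hC, hCS, hf, he⟩

theorem Linked.mono (h : Linked M S e f) (hST : S ⊆ T) : Linked M T e f := by
  rcases h with rfl | ⟨C, hC, hCS, he, hf⟩
  · exact .inl rfl
  · exact .inr ⟨C, hC, hCS.trans hST, he, hf⟩

theorem Linked.trans [M.Finitary] (hef : Linked M S e f) (hfg : Linked M S f g) :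
    Linked M S e g := by
  rcases hef with rfl | ⟨C, hC, hCS, he, hf⟩
  · exact hfg
  rcases hfg with rfl | ⟨D, hD, hDS, hf', hg⟩
  · exact .inr ⟨C, hC, hCS, he, hf⟩
  obtain ⟨F, hFCD, hF, heF, hgF⟩ := exists_isCircuit_subset_union hC hD ⟨f, hf, hf'⟩ he hg
  exact .inr ⟨F, hF, hFCD.trans (union_subset hCS hDS), heF, hgF⟩

theorem isConnSet_singleton (he : e ∈ M.E) : IsConnSet M {e} where
  subset_ground := singleton_subset_iff.2 he
  linked := by
    rintro x rfl y rfl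
    exact .refl M _ _

theorem isConnSet_of_isCircuit (hC : M.IsCircuit C) : IsConnSet M C where
  subset_ground := hC.subset_ground
  linked _ he _ hf := .inr ⟨C, hC, subset_rfl, he, hf⟩

theorem IsConnSet.union_isCircuit [M.Finitary] (hS : IsConnSet M S) (hC : M.IsCircuit C)
    (h : (S ∩ C).Nonempty) : IsConnSet M (S ∪ C) where
  subset_ground := union_subset hS.subset_ground hC.subset_ground
  linked := by
    obtain ⟨s, hsS, hsC⟩ := h
    have linked_s : ∀ x ∈ S ∪ C, Linked M (S ∪ C) x s := by
      rintro x (hx | hx)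
      · exact (hS.linked x hx s hsS).mono subset_union_left
      · exact .inr ⟨C, hC, subset_union_right, hx, hsC⟩
    exact fun e he f hf => (linked_s e he).trans (linked_s f hf).symm

theorem exists_isCircuit_nul_union_eq [M.Finitary] (hS : S.Finite) (hC : M.IsCircuit C)
    (hCS : ¬ C ⊆ S) (hne : (S ∩ C).Nonempty) :
    ∃ D ⊆ S ∪ C, M.IsCircuit D ∧ ¬ D ⊆ S ∧ (S ∩ D).Nonempty ∧
      nul M (S ∪ D) = nul M S + 1 := by
  obtain ⟨D, ⟨hDsub, hD, hDS, hDne⟩, hmin⟩ := exists_minimalFor_of_wellFoundedLT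
    (fun D => D ⊆ S ∪ C ∧ M.IsCircuit D ∧ ¬ D ⊆ S ∧ (S ∩ D).Nonempty)
    (fun D => (D \ S).ncard) ⟨C, subset_union_right, hC, hCS, hne⟩
  obtain ⟨x, hxD, hxS⟩ := not_subset.1 hDS
  have hfin : (S ∪ D).Finite := hS.union hD.finite
  refine ⟨D, hDsub, hD, hDS, hDne, ?_⟩
  rw [← nul_sdiff_singleton_add_one hD subset_union_right hxD hfin]
  congr 1
  refine (nul_eq_of_forall_isCircuit_subset (subset_sdiff_singleton subset_union_left hxS)
    hfin.sdiff ?_ fun F hF hFsub => ?_).symm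
  · exact fun y hy => hD.subset_ground (hy.1.1.resolve_left hy.2)
  by_contra hFS
  have hFD : F \ S ⊆ (D \ S) \ {x} := fun y hy =>
    ⟨⟨(hFsub hy.1).1.resolve_left hy.2, hy.2⟩, (hFsub hy.1).2⟩
  have hFne : (S ∩ F).Nonempty := by
    by_contra hemp
    have hsub : F ⊆ D := fun y hy => (hFD ⟨hy, fun h => hemp ⟨y, h, hy⟩⟩).1.1
    exact (hFsub (hF.eq_of_subset_isCircuit hD hsub ▸ hxD)).2 rfl
  have hFC : F ⊆ S ∪ C := fun y hy => (hFsub hy).1.elim .inl fun h => hDsub h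
  have hlt : (F \ S).ncard < (D \ S).ncard := ncard_lt_ncard
    (hFD.trans_ssubset (sdiff_singleton_ssubset.2 ⟨hxD, hxS⟩)) hD.finite.sdiff
  exact hlt.not_ge (hmin ⟨hFC, hF, hFS, hFne⟩ hlt.le)

theorem IsConnSet.exists_ear [M.Finitary] (hS : IsConnSet M S) (hT : IsConnSet M T) (hST : S ⊂ T)
    (hne : S.Nonempty) (hTfin : T.Finite) :
    ∃ S', S ⊂ S' ∧ S' ⊆ T ∧ IsConnSet M S' ∧ nul M S' = nul M S + 1 := by
  obtain ⟨s, hs⟩ := hne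
  obtain ⟨t, htT, htS⟩ := exists_of_ssubset hST
  obtain rfl | ⟨C, hC, hCT, hsC, htC⟩ := hT.linked s (hST.subset hs) t htT
  · exact absurd hs htS
  obtain ⟨D, hDsub, hD, hDS, hDne, hnul⟩ := exists_isCircuit_nul_union_eq
    (hTfin.subset hST.subset) hC (fun h => htS (h htC)) ⟨s, hs, hsC⟩
  exact ⟨S ∪ D, subset_union_left.ssubset_of_not_subset fun h => hDS (subset_union_right.trans h),
    union_subset hST.subset (hDsub.trans (union_subset hST.subset hCT)),
    hS.union_isCircuit hD hDne, hnul⟩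

theorem IsConnSet.ear_induction [M.Finitary] {P : Set α → Prop} (hT : IsConnSet M T)
    (hTfin : T.Finite) (he : e ∈ T) (singleton : P {e})
    (ear : ∀ S S', S ⊂ S' → S' ⊆ T → e ∈ S → IsConnSet M S' → nul M S' = nul M S + 1 →
      P S → P S') : P T := by
  have hfin : {S | S ⊆ T ∧ e ∈ S ∧ IsConnSet M S ∧ P S}.Finite :=
    hTfin.finite_subsets.subset fun S hS => hS.1
  obtain ⟨S, hS⟩ := hfin.exists_maximal ⟨{e}, singleton_subset_iff.2 he, rfl,
    isConnSet_singleton (hT.subset_ground he), singleton⟩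
  obtain ⟨hST, heS, hSc, hP⟩ := hS.prop
  obtain rfl | hss := hST.eq_or_ssubset
  · exact hP
  obtain ⟨S', hSS', hS'T, hc, hnul⟩ := hSc.exists_ear hT hss ⟨e, heS⟩ hTfin
  have hP' := ear S S' hSS' hS'T heS hc hnul hP
  exact (hSS'.not_subset (hS.le_of_ge ⟨hS'T, hSS'.subset heS, hc, hP'⟩ hSS'.subset)).elim

theorem finite_circuitsIn (M : Matroid α) (hS : S.Finite) : (circuitsIn M S).Finite :=
  hS.finite_subsets.subset fun _ h => h.2

theorem circuitsIn_mono (M : Matroid α) : Monotone (circuitsIn M) :=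
  fun _ _ hST _ h => ⟨h.1, h.2.trans hST⟩

theorem ncard_circuitsIn_sdiff_singleton_add (M : Matroid α) (hS : S.Finite) (e : α) :
    (circuitsIn M (S \ {e})).ncard + {C ∈ circuitsIn M S | e ∈ C}.ncard =
      (circuitsIn M S).ncard := by
  have hfin := finite_circuitsIn M hS
  rw [← ncard_union_eq ?_ (hfin.subset (circuitsIn_mono M sdiff_subset))
    (hfin.subset fun _ h => h.1)]
  · congr 1
    ext C
    constructor
    · rintro (⟨hC, hCS⟩ | ⟨hCS, -⟩)
      exacts [⟨hC, hCS.trans sdiff_subset⟩, hCS]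
    · rintro ⟨hC, hCS⟩
      by_cases heC : e ∈ C
      exacts [.inr ⟨⟨hC, hCS⟩, heC⟩, .inl ⟨hC, subset_sdiff_singleton hCS heC⟩]
  · exact disjoint_left.2 fun C hC hC' => (hC.2 hC'.2).2 rfl

theorem nul_singleton_le_one (M : Matroid α) (e : α) : nul M {e} ≤ 1 := by
  have h := rk_add_nul (M := M) (finite_singleton e)
  rw [ncard_singleton] at h
  lia

theorem IsConnSet.nul_le_ncard [M.Finitary] (hT : IsConnSet M T) (hTfin : T.Finite) (he : e ∈ T) :
    nul M T ≤ {C ∈ circuitsIn M T | e ∈ C}.ncard := by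
  have hfin {S : Set α} (hST : S ⊆ T) : {C ∈ circuitsIn M S | e ∈ C}.Finite :=
    (finite_circuitsIn M (hTfin.subset hST)).subset fun _ h => h.1
  refine hT.ear_induction (P := fun T => nul M T ≤ {C ∈ circuitsIn M T | e ∈ C}.ncard)
    hTfin he ?_ fun S S' hSS' hS'T heS hS' hnul hP => ?_
  · by_cases hind : M.Indep {e}
    · simp only [nul_eq_zero_of_indep hind, zero_le]
    obtain ⟨C, hCe, hC⟩ := ((Matroid.not_indep_iff
      (singleton_subset_iff.2 (hT.subset_ground he))).1 hind).exists_isCircuit_subset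
    have heC : e ∈ C := (subset_singleton_iff_eq.1 hCe).resolve_left hC.nonempty.ne_empty ▸ rfl
    exact (nul_singleton_le_one M e).trans <|
      (ncard_pos (hfin (singleton_subset_iff.2 he))).2 ⟨C, ⟨hC, hCe⟩, heC⟩
  · obtain ⟨x, hxS', hxS⟩ := exists_of_ssubset hSS'
    obtain rfl | ⟨C, hC, hCS', heC, hxC⟩ := hS'.linked e (hSS'.subset heS) x hxS'
    · exact absurd heS hxS
    have hlt : {C ∈ circuitsIn M S | e ∈ C}.ncard < {C ∈ circuitsIn M S' | e ∈ C}.ncard := by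
      refine ncard_lt_ncard ((ssubset_iff_of_subset ?_).2 ?_) (hfin hS'T)
      · exact fun D hD => ⟨circuitsIn_mono M hSS'.subset hD.1, hD.2⟩
      · exact ⟨C, ⟨⟨hC, hCS'⟩, heC⟩, fun h => hxS (h.1.2 hxC)⟩
    lia

theorem IsConnSet.nul_mul_le_ncard [M.Finitary] (hT : IsConnSet M T) (hTfin : T.Finite)
    (hne : T.Nonempty) : nul M T * (nul M T + 1) ≤ 2 * (circuitsIn M T).ncard := by
  obtain ⟨e, he⟩ := hne
  refine hT.ear_induction (P := fun T => nul M T * (nul M T + 1) ≤ 2 * (circuitsIn M T).ncard)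
    hTfin he ?_ fun S S' hSS' hS'T _ hS' hnul hP => ?_
  · have hthrough := (isConnSet_singleton (hT.subset_ground he)).nul_le_ncard
      (finite_singleton e) rfl
    have hle : {C ∈ circuitsIn M {e} | e ∈ C}.ncard ≤ (circuitsIn M {e}).ncard :=
      ncard_le_ncard (sep_subset _ _) (finite_circuitsIn M (finite_singleton e))
    nlinarith [nul_singleton_le_one M e]
  · have hS'fin := hTfin.subset hS'T
    obtain ⟨x, hxS', hxS⟩ := exists_of_ssubset hSS'
    have hthrough := hS'.nul_le_ncard hS'fin hxS'
    have havoid : (circuitsIn M S).ncard ≤ (circuitsIn M (S' \ {x})).ncard :=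
      ncard_le_ncard (circuitsIn_mono M (subset_sdiff_singleton hSS'.subset hxS))
        (finite_circuitsIn M hS'fin.sdiff)
    have hsplit := ncard_circuitsIn_sdiff_singleton_add M hS'fin x
    rw [hnul] at hthrough ⊢
    nlinarith

end Linked

/-- A matroid is simple if it has neither loops nor parallel pairs, that is, if each of its circuits
has at least three elements. -/
def IsSimple (M : Matroid α) : Prop := ∀ ⦃C⦄, M.IsCircuit C → 3 ≤ C.encard

section Simple

variable {S C : Set α}

theorem IsSimple.three_le_ncard [M.Finitary] (hM : IsSimple M) (hC : M.IsCircuit C) :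
    3 ≤ C.ncard := by
  have h := hM hC
  rw [← hC.finite.cast_ncard_eq] at h
  exact_mod_cast h

theorem IsSimple.indep_of_encard_le_two (hM : IsSimple M) (hS : S ⊆ M.E) (h : S.encard ≤ 2) :
    M.Indep S := by
  rw [Matroid.indep_iff_forall_subset_not_isCircuit hS]
  intro C hCS hC
  exact absurd ((hM hC).trans ((encard_le_encard hCS).trans h)) (by norm_num)

theorem IsSimple.two_le_rk_of_isCircuit_subset [M.Finitary] (hM : IsSimple M) (hC : M.IsCircuit C)
    (hCS : C ⊆ S) (hS : S.Finite) : 2 ≤ rk M S := by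
  obtain ⟨x, hx⟩ := hC.nonempty
  have hrk := ncard_le_rk_of_indep (hC.sdiff_singleton_indep hx) (sdiff_subset.trans hCS) hS
  rw [ncard_sdiff_singleton_of_mem hx] at hrk
  have := hM.three_le_ncard hC
  lia

theorem IsSimple.isCircuit_of_dep (hM : IsSimple M) (hS : M.Dep S) (h : S.encard ≤ 3) :
    M.IsCircuit S := by
  obtain ⟨C, hCS, hC⟩ := hS.exists_isCircuit_subset
  have hfin : S.Finite := finite_of_encard_le_coe h
  rwa [hfin.eq_of_subset_of_encard_le' hCS (h.trans (hM hC))] at hC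

end Simple

section SixElements

variable {S K T T' : Set α} {e x : α}

theorem ncard_eq_of_forall_ncard_le {𝓑 : Set (Set α)} {k d : ℕ} (hK : K.Finite)
    (hsub : ∀ B ∈ 𝓑, B ⊆ K) (hk : ∀ B ∈ 𝓑, k ≤ B.ncard)
    (hd : ∀ e ∈ K, {B ∈ 𝓑 | e ∈ B}.ncard ≤ d) (hle : K.ncard * d ≤ 𝓑.ncard * k) :
    ∀ B ∈ 𝓑, B.ncard = k := by
  classical
  have h𝓑 : 𝓑.Finite := hK.finite_subsets.subset hsub
  lift K to Finset α using hK
  lift 𝓑 to Finset (Set α) using h𝓑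
  simp only [Finset.mem_coe, ncard_coe_finset] at hk hd hle ⊢
  have hcount : ∑ e ∈ K, {B ∈ (𝓑 : Set (Set α)) | e ∈ B}.ncard = ∑ B ∈ 𝓑, B.ncard := by
    have hinc := Finset.sum_card_bipartiteAbove_eq_sum_card_bipartiteBelow
      (s := K) (t := 𝓑) fun e B => e ∈ B
    convert hinc using 2 with e _ B hB
    · rw [← ncard_coe_finset, Finset.coe_bipartiteAbove]; rfl
    · rw [← ncard_coe_finset, Finset.coe_bipartiteBelow]
      congr 1
      exact (sep_eq_of_subset (hsub B hB)).symm
  have hdsum := Finset.sum_le_card_nsmul K _ d hd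
  have hksum : ∑ _B ∈ 𝓑, k ≤ ∑ B ∈ 𝓑, B.ncard := Finset.sum_le_sum hk
  have heq : ∑ _B ∈ 𝓑, k = ∑ B ∈ 𝓑, B.ncard := by
    refine hksum.antisymm ?_
    simpa only [Finset.sum_const, smul_eq_mul] using hcount ▸ hdsum.trans hle
  exact fun B hB => ((Finset.sum_eq_sum_iff_of_le hk).1 heq B hB).symm

theorem IsSimple.three_le_ncard_circuitsIn [M.Finitary] (hM : IsSimple M) (hS : S ⊆ M.E)
    (hSfin : S.Finite) (hcard : S.ncard ≤ 5) (hnul : 2 ≤ nul M S) :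
    3 ≤ (circuitsIn M S).ncard := by
  obtain ⟨C, D, hC, hD, hne, hCS, hDS⟩ := exists_isCircuit_ne_of_two_le_nul hSfin hS hnul
  have hCD : C ∪ D ⊆ S := union_subset hCS hDS
  have hmeet : (C ∩ D).Nonempty := by
    by_contra hemp
    have hunion := ncard_union_eq (disjoint_iff_inter_eq_empty.2 (not_nonempty_iff_eq_empty.1 hemp))
      hC.finite hD.finite
    have hle := ncard_le_ncard hCD hSfin
    have hC3 := hM.three_le_ncard hC
    have hD3 := hM.three_le_ncard hD
    lia
  have hconn := (isConnSet_of_isCircuit hC).union_isCircuit hD hmeet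
  have hfin : (C ∪ D).Finite := hC.finite.union hD.finite
  have hquad := hconn.nul_mul_le_ncard hfin (hC.nonempty.mono subset_union_left)
  have htwo := two_le_nul_of_ne_of_subset hC hD hne subset_union_left subset_union_right hfin
  have hmono := ncard_le_ncard (circuitsIn_mono M hCD) (finite_circuitsIn M hSfin)
  nlinarith

theorem ncard_union_le_four_of_ncard_eq_three (hT : T.ncard = 3) (hT' : T'.ncard = 3)
    (he : e ∈ T ∩ T') (hx : x ∈ T ∩ T') (hne : e ≠ x) : (T ∪ T').ncard ≤ 4 := by
  have hTfin : T.Finite := finite_of_ncard_pos (by lia)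
  have hT'fin : T'.Finite := finite_of_ncard_pos (by lia)
  have hinter := ncard_le_ncard (pair_subset he hx) (hTfin.inter_of_left T')
  have hadd := ncard_union_add_ncard_inter T T' hTfin hT'fin
  rw [ncard_pair hne] at hinter
  lia

theorem IsSimple.exists_isCircuit_subset_union_mem_notMem [M.Finitary] (hM : IsSimple M)
    (hT : M.IsCircuit T) (hT' : M.IsCircuit T') (hTT' : T ≠ T') (hcard : (T ∪ T').ncard ≤ 4)
    (he : e ∈ T ∩ T') (hx : x ∈ T ∩ T') (hne : e ≠ x) :
    ∃ F ⊆ T ∪ T', M.IsCircuit F ∧ e ∈ F ∧ x ∉ F := by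
  obtain ⟨F, hFsub, hF⟩ := hT.elimination hT' hTT' x
  have hfin : (T ∪ T').Finite := hT.finite.union hT'.finite
  have hF3 := hM.three_le_ncard hF
  have hdel := ncard_sdiff_singleton_add_one (mem_union_left T' hx.1) hfin
  have hFeq : F = (T ∪ T') \ {x} := eq_of_subset_of_ncard_le hFsub (by lia) hfin.sdiff
  exact ⟨F, hFsub.trans sdiff_subset, hF, hFeq ▸ ⟨.inl he.1, hne⟩, fun h => (hFsub h).2 rfl⟩

theorem IsSimple.inter_eq_singleton_of_ncard_eq_three [M.Finitary] (hM : IsSimple M)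
    (hK : IsConnSet M K) (hKfin : K.Finite) (hKcard : 5 ≤ K.ncard)
    (hdeg : {C ∈ circuitsIn M K | e ∈ C}.ncard ≤ 3) (hT : T ∈ circuitsIn M K)
    (hT' : T' ∈ circuitsIn M K) (hne : T ≠ T') (hT3 : T.ncard = 3) (hT'3 : T'.ncard = 3)
    (he : e ∈ T ∩ T') : T ∩ T' = {e} := by
  refine eq_singleton_iff_unique_mem.2 ⟨he, fun x hx => by_contra fun hxe => ?_⟩
  have hUK : T ∪ T' ⊆ K := union_subset hT.2 hT'.2
  have hUcard := ncard_union_le_four_of_ncard_eq_three hT3 hT'3 he hx (Ne.symm hxe)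
  obtain ⟨F, hFU, hF, heF, hxF⟩ := hM.exists_isCircuit_subset_union_mem_notMem hT.1 hT'.1 hne
    hUcard he hx (Ne.symm hxe)
  have hthree : ({T, T', F} : Set (Set α)) = {C ∈ circuitsIn M K | e ∈ C} := by
    refine eq_of_subset_of_ncard_le ?_ (hdeg.trans ?_)
      ((finite_circuitsIn M hKfin).subset fun _ h => h.1)
    · rintro C (rfl | rfl | rfl)
      exacts [⟨hT, he.1⟩, ⟨hT', he.2⟩, ⟨⟨hF, hFU.trans hUK⟩, heF⟩]
    · rw [ncard_eq_three.2 ⟨T, T', F, hne, fun h => hxF (h ▸ hx.1), fun h => hxF (h ▸ hx.2), rfl⟩]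
  obtain ⟨f, hfK, hfU⟩ := exists_mem_notMem_of_ncard_lt_ncard (hUcard.trans_lt hKcard)
    (hKfin.subset hUK)
  obtain rfl | ⟨C, hC, hCK, heC, hfC⟩ := hK.linked e (hT.2 he.1) f hfK
  · exact hfU (.inl he.1)
  · obtain rfl | rfl | rfl : C ∈ ({T, T', F} : Set (Set α)) := hthree ▸ ⟨⟨hC, hCK⟩, heC⟩
    exacts [hfU (.inl hfC), hfU (.inr hfC), hfU (hFU hfC)]

theorem seven_le_ncard_of_inter_eq_singleton {T₁ T₂ T₃ : Set α} (hK : K.Finite) (h₁ : T₁ ⊆ K)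
    (h₂ : T₂ ⊆ K) (h₃ : T₃ ⊆ K) (hT₁ : T₁.ncard = 3) (hT₂ : T₂.ncard = 3) (hT₃ : T₃.ncard = 3)
    (h₁₂ : T₁ ∩ T₂ = {e}) (h₁₃ : T₁ ∩ T₃ = {e}) (h₂₃ : T₂ ∩ T₃ = {e}) : 7 ≤ K.ncard := by
  have h := ncard_union_add_ncard_inter T₁ T₂ (hK.subset h₁) (hK.subset h₂)
  have h' := ncard_union_add_ncard_inter (T₁ ∪ T₂) T₃ (hK.subset (union_subset h₁ h₂))
    (hK.subset h₃)
  rw [h₁₂, ncard_singleton] at h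
  rw [union_inter_distrib_right, h₁₃, h₂₃, union_self, ncard_singleton] at h'
  have hle := ncard_le_ncard (union_subset (union_subset h₁ h₂) h₃) hK
  lia

theorem IsSimple.three_le_ncard_circuitsIn_sdiff_singleton [M.Finitary] (hM : IsSimple M)
    (hK : IsConnSet M K) (hKcard : K.ncard = 6) (hnul : nul M K = 3) (he : e ∈ K) :
    3 ≤ (circuitsIn M (K \ {e})).ncard := by
  have hKfin : K.Finite := finite_of_ncard_pos (by lia)
  have hthrough := hK.nul_le_ncard hKfin he
  obtain ⟨C, ⟨hC, hCK⟩, heC⟩ := nonempty_of_ncard_ne_zero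
    (show {C ∈ circuitsIn M K | e ∈ C}.ncard ≠ 0 by lia)
  have hcard := ncard_sdiff_singleton_add_one he hKfin
  have hnul' := nul_sdiff_singleton_add_one hC hCK heC hKfin
  exact hM.three_le_ncard_circuitsIn (sdiff_subset.trans hK.subset_ground) hKfin.sdiff
    (by lia) (by lia)

/-- Otherwise there would be exactly three circuits through each element and six in total. Counting
incidences, they all are triangles, and the three triangles through an element, which meet in
nothing else, span seven elements. -/
theorem IsSimple.seven_le_ncard_circuitsIn [M.Finitary] (hM : IsSimple M) (hK : IsConnSet M K)
    (hKcard : K.ncard = 6) (hnul : nul M K = 3) : 7 ≤ (circuitsIn M K).ncard := by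
  have hKfin : K.Finite := finite_of_ncard_pos (by lia)
  by_contra hlt
  have hsplit := ncard_circuitsIn_sdiff_singleton_add M hKfin
  have havoid (e) (he : e ∈ K) :=
    hM.three_le_ncard_circuitsIn_sdiff_singleton hK hKcard hnul he
  have hdeg (e) (he : e ∈ K) : {C ∈ circuitsIn M K | e ∈ C}.ncard ≤ 3 := by
    have := havoid e he
    have := hsplit e
    lia
  obtain ⟨e, he⟩ : K.Nonempty := nonempty_of_ncard_ne_zero (by lia)
  have hthrough := hK.nul_le_ncard hKfin he
  have hsix : 6 ≤ (circuitsIn M K).ncard := by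
    have := havoid e he
    have := hsplit e
    lia
  have htri : ∀ C ∈ circuitsIn M K, C.ncard = 3 :=
    ncard_eq_of_forall_ncard_le hKfin (fun C hC => hC.2) (fun C hC => hM.three_le_ncard hC.1) hdeg
      (by lia)
  obtain ⟨T₁, T₂, T₃, ⟨h₁, he₁⟩, ⟨h₂, he₂⟩, ⟨h₃, he₃⟩, h₁₂, h₁₃, h₂₃⟩ :=
    (two_lt_ncard_iff ((finite_circuitsIn M hKfin).subset fun _ h => h.1)).1
      (show 2 < {C ∈ circuitsIn M K | e ∈ C}.ncard by lia)
  have hinter {T T'} (hT : T ∈ circuitsIn M K) (hT' : T' ∈ circuitsIn M K) (hne : T ≠ T') :=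
    hM.inter_eq_singleton_of_ncard_eq_three hK hKfin (by lia) (hdeg e he) hT hT' hne
      (htri T hT) (htri T' hT')
  have hseven := seven_le_ncard_of_inter_eq_singleton hKfin h₁.2 h₂.2 h₃.2 (htri T₁ h₁)
    (htri T₂ h₂) (htri T₃ h₃) (hinter h₁ h₂ h₁₂ ⟨he₁, he₂⟩) (hinter h₁ h₃ h₁₃ ⟨he₁, he₃⟩)
    (hinter h₂ h₃ h₂₃ ⟨he₂, he₃⟩)
  lia

end SixElements

section Derived

variable {K C D : Set α} {p x y : α}

theorem le_encard_of_mem_eps {β : Type*} {𝓔 : Set (Set β)} {n : ℕ∞} (h : ∀ A ∈ 𝓔, n ≤ A.encard)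
    {A : Set β} (hA : A ∈ eps 𝓔) : n ≤ A.encard := by
  have le_encard_union_sdiff {A₁ A₂ : Set β} {v : β} (h₁ : A₁ ∈ 𝓔) (hv : v ∈ A₁ ∩ A₂)
      (hsub : ¬ A₂ ⊆ A₁) : n ≤ ((A₁ ∪ A₂) \ {v}).encard := by
    obtain ⟨y, hy₂, hy₁⟩ := not_subset.1 hsub
    calc n ≤ A₁.encard := h A₁ h₁
      _ = (insert y (A₁ \ {v})).encard := (encard_exchange hy₁ hv.1).symm
      _ ≤ ((A₁ ∪ A₂) \ {v}).encard := encard_le_encard <| insert_subset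
        ⟨.inr hy₂, fun h => hy₁ (h ▸ hv.1)⟩ (sdiff_subset_sdiff_left subset_union_left)
  rcases hA with hA | ⟨A₁, h₁, A₂, h₂, hn, v, hv, rfl⟩
  · exact h A hA
  by_cases hsub : A₂ ⊆ A₁
  · have hsub' : ¬ A₁ ⊆ A₂ := fun h => hn (by rwa [inter_eq_left.2 h])
    rw [union_comm]
    exact le_encard_union_sdiff h₂ hv.symm hsub'
  · exact le_encard_union_sdiff h₁ hv hsub

theorem three_le_encard_of_mem_family_zero [M.Finitary] {A : Set (Set α)} (hA : A ∈ family M 0) :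
    3 ≤ A.encard := by
  obtain ⟨hAM, hlt⟩ := hA
  by_contra! hlt3
  have hfin : A.Finite := finite_of_encard_le_coe (k := 3) hlt3.le
  have hUfin : (⋃₀ A).Finite := hfin.sUnion fun C hC => Matroid.IsCircuit.finite (hAM hC)
  rw [← hfin.cast_ncard_eq] at hlt hlt3
  rw [← cast_nul hUfin] at hlt
  norm_cast at hlt hlt3
  obtain h | h | h : A.ncard = 0 ∨ A.ncard = 1 ∨ A.ncard = 2 := by lia
  · lia
  · obtain ⟨C, rfl⟩ := ncard_eq_one.1 h
    rw [sUnion_singleton, nul_eq_one_of_isCircuit (hAM rfl)] at hlt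
    lia
  · obtain ⟨C, D, hne, rfl⟩ := ncard_eq_two.1 h
    have htwo := two_le_nul_of_ne_of_subset (hAM (.inl rfl)) (hAM (.inr rfl)) hne
      (subset_sUnion_of_mem (.inl rfl)) (subset_sUnion_of_mem (.inr rfl)) hUfin
    lia

theorem three_le_encard_of_mem_family [M.Finitary] (i : ℕ) {A : Set (Set α)}
    (hA : A ∈ family M i) : 3 ≤ A.encard := by
  induction i generalizing A with
  | zero => exact three_le_encard_of_mem_family_zero hA
  | succ i ih =>
    obtain ⟨-, B, hB, hBA⟩ := hA
    exact (le_encard_of_mem_eps (fun _ => ih) hB).trans (encard_le_encard hBA)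

theorem isSimple_derived (M : Matroid α) [M.Finite] : IsSimple (derived M) := by
  intro A hA
  obtain ⟨i, hi⟩ := mem_iUnion.1 ((derived_dep_iff M A).1 hA.dep)
  exact three_le_encard_of_mem_family i hi

theorem exists_isCircuit_notMem_nul_union_le_two [M.Finitary] (hC : M.IsCircuit C)
    (hD : M.IsCircuit D) (hCD : (C ∩ D).Nonempty) (hp : p ∈ C \ D) :
    ∃ F ⊆ C ∪ D, M.IsCircuit F ∧ p ∉ F ∧ (C ∩ F).Nonempty ∧ (F ∩ D).Nonempty ∧
      nul M (C ∪ F) ≤ 2 := by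
  have hDC : ¬ D ⊆ C := fun h => hp.2 (hD.eq_of_subset_isCircuit hC h ▸ hp.1)
  obtain ⟨X, hXsub, hX, hXC, -, hXnul⟩ := exists_isCircuit_nul_union_eq hC.finite hD hDC hCD
  obtain ⟨F, hFsub, hF⟩ : ∃ F ⊆ (C ∪ X) \ {p}, M.IsCircuit F :=
    hC.elimination hX (fun h => hXC h.symm.subset) p
  have hpF : p ∉ F := fun h => (hFsub h).2 rfl
  have hFCD : F ⊆ C ∪ D := fun y hy => (hFsub hy).1.elim .inl fun h => hXsub h
  have hFD : (F ∩ D).Nonempty := by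
    obtain ⟨y, hyF, hyC⟩ := not_subset.1 fun h : F ⊆ C =>
      hpF (hF.eq_of_subset_isCircuit hC h ▸ hp.1)
    exact ⟨y, hyF, (hFCD hyF).resolve_left hyC⟩
  have hCF : (C ∩ F).Nonempty := by
    by_contra hemp
    have hsub : F ⊆ D := fun y hy => (hFCD hy).resolve_left fun h => hemp ⟨y, h, hy⟩
    obtain rfl := hF.eq_of_subset_isCircuit hD hsub
    exact hemp hCD
  refine ⟨F, hFCD, hF, hpF, hCF, hFD, ?_⟩
  have hmono := nul_mono (M := M) (union_subset subset_union_left (hFsub.trans sdiff_subset))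
    (hC.finite.union hX.finite)
  rw [hXnul, nul_eq_one_of_isCircuit hC] at hmono
  exact hmono

variable [M.Finite]

instance finite_derived : (derived M).Finite := ⟨circuits_finite M⟩

theorem derived_dep_of_nul_lt {A : Set (Set α)} (hA : A ⊆ circuits M)
    (h : nul M (⋃₀ A) < A.ncard) : (derived M).Dep A := by
  have hU : (⋃₀ A).Finite :=
    M.ground_finite.subset (sUnion_subset fun C hC => (hA hC).subset_ground)
  rw [derived_dep_iff]
  refine mem_iUnion.2 ⟨0, hA, ?_⟩
  rw [← cast_nul hU, ← ((circuits_finite M).subset hA).cast_ncard_eq]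
  exact_mod_cast h

theorem rk_derived_circuitsIn_le (hK : K.Finite) : rk (derived M) (circuitsIn M K) ≤ nul M K := by
  refine rk_le_of_forall_indep (finite_circuitsIn M hK) fun A hAK hA => ?_
  by_contra! hlt
  have hUK : ⋃₀ A ⊆ K := sUnion_subset fun C hC => (hAK hC).2
  exact (derived_dep_of_nul_lt (fun C hC => (hAK hC).1)
    ((nul_mono hUK hK).trans_lt hlt)).not_indep hA

theorem linked_derived_of_nul_union_le_two (hC : M.IsCircuit C) (hD : M.IsCircuit D)
    (hCD : (C ∩ D).Nonempty) (hnul : nul M (C ∪ D) ≤ 2) :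
    Linked (derived M) (derived M).E C D := by
  obtain rfl | hne := eq_or_ne C D
  · exact .refl _ _ C
  obtain ⟨q, hqC, hqD⟩ := hCD
  obtain ⟨F, hFsub, hF⟩ := hC.elimination hD hne q
  have hqF : q ∉ F := fun h => (hFsub h).2 rfl
  have hcard : ({C, D, F} : Set (Set α)).ncard = 3 :=
    ncard_eq_three.2 ⟨C, D, F, hne, fun h => hqF (h ▸ hqC), fun h => hqF (h ▸ hqD), rfl⟩
  have hsub : {C, D, F} ⊆ circuits M := by
    rintro X (rfl | rfl | rfl)
    exacts [hC, hD, hF]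
  have hUsub : ⋃₀ {C, D, F} ⊆ C ∪ D := by
    refine sUnion_subset ?_
    rintro X (rfl | rfl | rfl)
    exacts [subset_union_left, subset_union_right, hFsub.trans sdiff_subset]
  have hmono := nul_mono (M := M) hUsub (hC.finite.union hD.finite)
  have hdep : (derived M).Dep {C, D, F} := derived_dep_of_nul_lt hsub (by lia)
  have hcirc := (isSimple_derived M).isCircuit_of_dep hdep
    (by rw [← (finite_of_ncard_pos (by lia)).cast_ncard_eq, hcard]; rfl)
  exact .inr ⟨_, hcirc, hsub, .inl rfl, .inr (.inl rfl)⟩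

theorem linked_derived_of_inter_nonempty (hC : M.IsCircuit C) (hD : M.IsCircuit D)
    (hCD : (C ∩ D).Nonempty) : Linked (derived M) (derived M).E C D := by
  induction hn : (C \ D).ncard using Nat.strong_induction_on generalizing C with
  | _ n ih =>
  obtain hsub | ⟨p, hp⟩ := (C \ D).eq_empty_or_nonempty
  · obtain rfl := hC.eq_of_subset_isCircuit hD (sdiff_eq_empty.1 hsub)
    exact .refl _ _ C
  obtain ⟨F, hFsub, hF, hpF, hCF, hFD, hnul⟩ :=
    exists_isCircuit_notMem_nul_union_le_two hC hD hCD hp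
  have hlt : (F \ D).ncard < (C \ D).ncard := by
    refine ncard_lt_ncard ((ssubset_iff_of_subset ?_).2 ⟨p, hp, fun h => hpF h.1⟩) hC.finite.sdiff
    exact fun y hy => ⟨(hFsub hy.1).resolve_right hy.2, hy.2⟩
  exact (linked_derived_of_nul_union_le_two hC hF hCF hnul).trans (ih _ (hn ▸ hlt) hF hFD rfl)

theorem linked_derived (hC : M.IsCircuit C) (hD : M.IsCircuit D) (hx : x ∈ C) (hy : y ∈ D)
    (hxy : Linked M M.E x y) : Linked (derived M) (derived M).E C D := by
  obtain rfl | ⟨F, hF, -, hxF, hyF⟩ := hxy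
  · exact linked_derived_of_inter_nonempty hC hD ⟨x, hx, hy⟩
  · exact (linked_derived_of_inter_nonempty hC hF ⟨x, hx, hxF⟩).trans
      (linked_derived_of_inter_nonempty hF hD ⟨y, hyF, hy⟩)

end Derived

section Component

variable [M.Finitary]

/-- The equivalence relation on the ground set of `M` whose classes are the connected components
of `M`. -/
def componentSetoid (M : Matroid α) [M.Finitary] : Setoid M.E where
  r x y := Linked M M.E x y
  iseqv := ⟨fun x => .refl M _ x, .symm, .trans⟩

/-- The connected components of `M`. -/
abbrev Component (M : Matroid α) [M.Finitary] : Type _ := Quotient (componentSetoid M)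

/-- The set of elements of a connected component of `M`. -/
def Component.carrier (K : Component M) : Set α := Subtype.val '' {x : M.E | ⟦x⟧ = K}

namespace Component

variable {K : Component M} {C : Set α}

theorem coe_mem_carrier {x : M.E} : (x : α) ∈ K.carrier ↔ ⟦x⟧ = K :=
  Subtype.val_injective.mem_set_image

theorem carrier_subset_ground (K : Component M) : K.carrier ⊆ M.E :=
  Subtype.coe_image_subset _ _

theorem iUnion_carrier (M : Matroid α) [M.Finitary] : ⋃ K : Component M, K.carrier = M.E :=
  (iUnion_subset carrier_subset_ground).antisymm fun x hx =>
    mem_iUnion.2 ⟨⟦⟨x, hx⟩⟧, coe_mem_carrier.2 rfl⟩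

theorem pairwise_disjoint_carrier (M : Matroid α) [M.Finitary] :
    Pairwise fun K L : Component M => Disjoint K.carrier L.carrier := by
  refine fun K L hKL => disjoint_left.2 fun x hxK hxL => hKL ?_
  lift x to M.E using K.carrier_subset_ground hxK
  rw [← coe_mem_carrier.1 hxK, ← coe_mem_carrier.1 hxL]

theorem isCircuit_subset_carrier (hC : M.IsCircuit C) (h : (C ∩ K.carrier).Nonempty) :
    C ⊆ K.carrier := by
  obtain ⟨x, hxC, hxK⟩ := h
  intro y hyC
  lift x to M.E using hC.subset_ground hxC
  lift y to M.E using hC.subset_ground hyC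
  have hyx : Linked M M.E y x := .inr ⟨C, hC, hC.subset_ground, hyC, hxC⟩
  exact coe_mem_carrier.2 ((Quotient.sound hyx).trans (coe_mem_carrier.1 hxK))

theorem carrier_nonempty (K : Component M) : K.carrier.Nonempty := by
  obtain ⟨x, rfl⟩ := K.exists_rep
  exact ⟨x, coe_mem_carrier.2 rfl⟩

theorem isConnSet_carrier (K : Component M) : IsConnSet M K.carrier where
  subset_ground := K.carrier_subset_ground
  linked := by
    rintro _ ⟨x, hx, rfl⟩ _ ⟨y, hy, rfl⟩
    obtain hxy | ⟨C, hC, -, hxC, hyC⟩ : Linked M M.E x y := Quotient.exact (hx.trans hy.symm)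
    · exact .inl hxy
    · have hCK := isCircuit_subset_carrier hC ⟨x, hxC, coe_mem_carrier.2 hx⟩
      exact .inr ⟨C, hC, hCK, hxC, hyC⟩

end Component

end Component

theorem eq_disjointSigma_restrict {ι : Type*} {K : ι → Set α}
    (hK : Pairwise (Function.onFun Disjoint fun i => (M.restrict (K i)).E)) (hE : ⋃ i, K i = M.E)
    (hcirc : ∀ i C, M.IsCircuit C → (C ∩ K i).Nonempty → C ⊆ K i) :
    M = Matroid.disjointSigma (fun i => M.restrict (K i)) hK := by
  refine Matroid.ext_indep (by simp [hE]) fun I hI => ?_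
  simp only [Matroid.disjointSigma_indep_iff, Matroid.restrict_indep_iff,
    Matroid.restrict_ground_eq]
  refine ⟨fun h => ⟨fun i => ⟨h.subset inter_subset_left, inter_subset_right⟩, hE ▸ hI⟩,
    fun ⟨h, _⟩ => (Matroid.indep_iff_forall_subset_not_isCircuit hI).2 fun C hCI hC => ?_⟩
  obtain ⟨x, hx⟩ := hC.nonempty
  obtain ⟨i, hi⟩ := mem_iUnion.1 (hE ▸ hC.subset_ground hx)
  exact hC.not_indep ((h i).1.subset (subset_inter hCI (hcirc i C hC ⟨x, hx, hi⟩)))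

section Map

variable {β : Type*} {g : α → β} {hg : InjOn g M.E}

theorem Isomorphic.exists_eq_map [Nonempty β] {N : Matroid β} (h : Isomorphic N M) :
    ∃ (g : α → β) (hg : InjOn g M.E), N = M.map g hg := by
  obtain ⟨e, he⟩ := h
  let g : α → β :=
    Function.extend Subtype.val (fun y => (e.symm y : β)) fun _ => Classical.arbitrary β
  have g_coe (y : M.E) : g y = e.symm y := Subtype.val_injective.extend_apply _ _ y
  have g_image (I : Set N.E) : g '' (Subtype.val '' (e '' I)) = Subtype.val '' I := by
    simp only [image_image, g_coe, e.symm_apply_apply]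
  have hg : InjOn g M.E := fun x hx y hy hxy => by
    lift x to M.E using hx
    lift y to M.E using hy
    rw [g_coe, g_coe] at hxy
    rw [e.symm.injective (Subtype.ext hxy)]
  refine ⟨g, hg, Matroid.ext_indep ?_ fun I hI => ?_⟩
  · simpa only [Matroid.map_ground, image_univ, e.range_eq_univ, Subtype.range_coe] using
      (g_image univ).symm
  · obtain ⟨J, rfl⟩ : ∃ J : Set N.E, Subtype.val '' J = I :=
      ⟨_, (Subtype.image_preimage_coe _ _).trans (inter_eq_right.2 hI)⟩
    rw [he, ← g_image, Matroid.map_image_indep_iff (Subtype.coe_image_subset _ _)]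

theorem isCircuit_map_image_iff {C : Set α} (hC : C ⊆ M.E) :
    (M.map g hg).IsCircuit (g '' C) ↔ M.IsCircuit C := by
  have hsdiff : ∀ x ∈ C, (M.map g hg).Indep (g '' C \ {g x}) ↔ M.Indep (C \ {x}) := fun x hx => by
    rw [← image_singleton, ← (hg.mono hC).image_sdiff_subset (singleton_subset_iff.2 hx),
      Matroid.map_image_indep_iff (sdiff_subset.trans hC)]
  simp only [Matroid.isCircuit_iff_dep_forall_sdiff_singleton_indep, forall_mem_image, Matroid.Dep,
    Matroid.map_image_indep_iff hC, Matroid.map_ground, hg.image_subset_image_iff hC subset_rfl]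
  exact and_congr_right fun _ => forall₂_congr hsdiff

theorem isSimple_of_isSimple_map (h : IsSimple (M.map g hg)) : IsSimple M := fun C hC => by
  have := h ((isCircuit_map_image_iff hC.subset_ground).2 hC)
  rwa [(hg.mono hC.subset_ground).encard_image] at this

theorem rk_map_image {S : Set α} (hS : S ⊆ M.E) : rk (M.map g hg) (g '' S) = rk M S := by
  rw [rk, rk, M.eRk_map hg hS]

theorem linked_of_linked_map {x y : α} (hx : x ∈ M.E) (hy : y ∈ M.E)
    (h : Linked (M.map g hg) (M.map g hg).E (g x) (g y)) : Linked M M.E x y := by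
  obtain hxy | ⟨_, hC, hCE, hxC, hyC⟩ := h
  · exact .inl (hg hx hy hxy)
  obtain ⟨C, hCM, rfl⟩ := subset_image_iff.1 hCE
  exact .inr ⟨C, (isCircuit_map_image_iff hCM).1 hC, hCM, (hg.mem_image_iff hCM hx).1 hxC,
    (hg.mem_image_iff hCM hy).1 hyC⟩

end Map

theorem exists_perm_quotient_of_reflects {X : Type*} (s : Setoid X) [Finite (Quotient s)]
    (φ : X → X) (hφ : ∀ x y, s (φ x) (φ y) → s x y) :
    ∃ τ : Equiv.Perm (Quotient s), ∀ x, τ ⟦x⟧ = ⟦φ x⟧ := by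
  let ρ : Quotient s → Quotient s := fun q => ⟦φ q.out⟧
  have eq_of_map_eq {x : X} {q : Quotient s} (h : ⟦φ x⟧ = ρ q) : ⟦x⟧ = q :=
    (Quotient.sound (hφ _ _ (Quotient.exact h))).trans q.out_eq
  have hρ : ρ.Injective := fun p q hpq => p.out_eq.symm.trans (eq_of_map_eq hpq)
  refine ⟨Equiv.ofBijective ρ (Finite.injective_iff_bijective.1 hρ), fun x => ?_⟩
  obtain ⟨q, hq⟩ := (Finite.injective_iff_surjective.1 hρ) ⟦φ x⟧
  rw [Equiv.ofBijective_apply, eq_of_map_eq hq.symm, hq]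

theorem apply_perm_eq_of_forall_apply_perm_le {ι N : Type*} [Finite ι] [AddCommMonoid N]
    [PartialOrder N] [IsOrderedCancelAddMonoid N] {f : ι → N} {σ : Equiv.Perm ι}
    (h : ∀ i, f (σ i) ≤ f i) (i : ι) : f (σ i) = f i := by
  have := Fintype.ofFinite ι
  exact (Finset.sum_eq_sum_iff_of_le fun i _ => h i).1 (Equiv.sum_comp σ f) i (Finset.mem_univ i)

theorem perm_apply_eq_and_eq_and_le_three {ι : Type*} [Finite ι] {τ : Equiv.Perm ι} {r η : ι → ℕ}
    (two_le : ∀ i, 2 ≤ r i) (r_le : ∀ i, r i ≤ η (τ i))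
    (quadratic : ∀ i, η (τ i) * (η (τ i) + 1) ≤ 2 * (r i + η i)) (i : ι) :
    η (τ i) = η i ∧ r i = η i ∧ η i ≤ 3 := by
  have two_le_η (i : ι) : 2 ≤ η i := by
    simpa only [τ.apply_symm_apply] using (two_le (τ.symm i)).trans (r_le (τ.symm i))
  have two_mul_le (i : ι) : 2 * η (τ i) ≤ r i + η i := by
    obtain h | h := (two_le_η (τ i)).eq_or_lt
    · have := two_le i
      have := two_le_η i
      lia
    · nlinarith [quadratic i]
  have η_perm : η (τ i) = η i := apply_perm_eq_of_forall_apply_perm_le (f := η)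
    (fun j => by have := two_mul_le j; have := r_le j; lia) i
  have r_eq : r i = η i := by
    have := two_mul_le i
    have := r_le i
    lia
  refine ⟨η_perm, r_eq, ?_⟩
  have := quadratic i
  rw [η_perm, r_eq] at this
  nlinarith [two_le_η i]

section SelfDerived

variable [M.Finite] {g : α → Set α} {hg : InjOn g M.E}

instance finite_component : Finite (Component M) :=
  have := M.ground_finite.to_subtype
  Quotient.finite _

theorem exists_perm_component_of_derived_eq_map (h : derived M = M.map g hg) :
    ∃ τ : Equiv.Perm (Component M), ∀ K, circuitsIn M (τ K).carrier = g '' K.carrier := by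
  have image_ground : g '' M.E = circuits M := (congrArg Matroid.E h).symm
  have isCircuit_apply (x : M.E) : M.IsCircuit (g x) := image_ground.subset (mem_image_of_mem g x.2)
  choose φ hφ using fun x => (isCircuit_apply x).nonempty
  let φ' : M.E → M.E := fun x => ⟨φ x, (isCircuit_apply x).subset_ground (hφ x)⟩
  obtain ⟨τ, hτ⟩ := exists_perm_quotient_of_reflects (componentSetoid M) φ' fun x y hxy =>
    linked_of_linked_map x.2 y.2
      (h ▸ linked_derived (isCircuit_apply x) (isCircuit_apply y) (hφ x) (hφ y) hxy)
  refine ⟨τ, fun K => subset_antisymm ?_ ?_⟩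
  · rintro C ⟨hC, hCK⟩
    obtain ⟨x, hx, rfl⟩ := image_ground.superset hC
    have hφK : ⟦φ' ⟨x, hx⟩⟧ = τ K := Component.coe_mem_carrier.1 (hCK (hφ ⟨x, hx⟩))
    exact mem_image_of_mem g (Component.coe_mem_carrier (x := ⟨x, hx⟩).2
      (τ.injective ((hτ _).trans hφK)))
  · rintro _ ⟨_, ⟨x, rfl, rfl⟩, rfl⟩
    exact ⟨isCircuit_apply x, Component.isCircuit_subset_carrier (isCircuit_apply x)
      ⟨φ x, hφ x, Component.coe_mem_carrier (x := φ' x).2 (hτ x).symm⟩⟩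

theorem rk_carrier_eq_two_and_nul_carrier_eq_two (h : derived M = M.map g hg) (K : Component M) :
    rk M K.carrier = 2 ∧ nul M K.carrier = 2 := by
  have hM : IsSimple M := isSimple_of_isSimple_map (h ▸ isSimple_derived M)
  have finite_carrier (K : Component M) := M.ground_finite.subset K.carrier_subset_ground
  obtain ⟨τ, hτ⟩ := exists_perm_component_of_derived_eq_map h
  have ncard_circuitsIn (K : Component M) :
      (circuitsIn M (τ K).carrier).ncard = rk M K.carrier + nul M K.carrier := by
    rw [hτ, (hg.mono K.carrier_subset_ground).ncard_image, rk_add_nul (finite_carrier K)]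
  have rk_le_nul (K : Component M) : rk M K.carrier ≤ nul M (τ K).carrier := by
    rw [← rk_map_image (hg := hg) K.carrier_subset_ground, ← h, ← hτ]
    exact rk_derived_circuitsIn_le (finite_carrier _)
  have two_le_rk (K : Component M) : 2 ≤ rk M K.carrier := by
    obtain ⟨K, rfl⟩ := τ.surjective K
    obtain ⟨C, hC, hCK⟩ : (circuitsIn M (τ K).carrier).Nonempty := hτ K ▸ K.carrier_nonempty.image g
    exact hM.two_le_rk_of_isCircuit_subset hC hCK (finite_carrier _)
  have quadratic (K : Component M) : nul M (τ K).carrier * (nul M (τ K).carrier + 1) ≤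
      2 * (rk M K.carrier + nul M K.carrier) :=
    ncard_circuitsIn K ▸ (Component.isConnSet_carrier _).nul_mul_le_ncard (finite_carrier _)
      (Component.carrier_nonempty _)
  have key := perm_apply_eq_and_eq_and_le_three (η := fun K : Component M => nul M K.carrier)
    two_le_rk rk_le_nul quadratic
  obtain ⟨nul_perm, rk_eq, nul_le⟩ := key K
  obtain ⟨-, rk_eq', -⟩ := key (τ K)
  have nul_ne_three : nul M (τ K).carrier ≠ 3 := fun hnul => by
    have hcard := rk_add_nul (M := M) (finite_carrier (τ K))
    have := hM.seven_le_ncard_circuitsIn (Component.isConnSet_carrier (τ K)) (by lia) hnul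
    have := ncard_circuitsIn K
    lia
  have := two_le_rk K
  lia

end SelfDerived

section Uniform

variable {r n : ℕ}

theorem uniform_indep_iff {I : Set (Fin n)} : (uniform r n).Indep I ↔ I.ncard ≤ r := Iff.rfl

theorem uniform_isCircuit_iff {C : Set (Fin n)} : (uniform r n).IsCircuit C ↔ C.ncard = r + 1 := by
  have dep_iff (D : Set (Fin n)) : (uniform r n).Dep D ↔ r < D.ncard := by
    rw [← Matroid.not_indep_iff (subset_univ D), uniform_indep_iff, not_le]
  refine ⟨fun hC => ?_, fun hC => Matroid.isCircuit_iff.2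
    ⟨(dep_iff C).2 (by lia), fun D hD hDC => eq_of_subset_of_ncard_le hDC ?_⟩⟩
  · have hdep := (dep_iff C).1 hC.dep
    obtain ⟨x, hx⟩ := hC.nonempty
    have hindep := uniform_indep_iff.1 (hC.sdiff_singleton_indep hx)
    rw [ncard_sdiff_singleton_of_mem hx] at hindep
    lia
  · have := (dep_iff D).1 hD
    lia

theorem ncard_circuits_uniform : (circuits (uniform r n)).ncard = n.choose (r + 1) := by
  have : circuits (uniform r n) = (fun T : Finset (Fin n) => (T : Set (Fin n))) ''
      powersetCard (Fin n) (r + 1) := by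
    ext C
    obtain ⟨T, rfl⟩ := C.toFinite.exists_finset_coe
    simp [circuits, uniform_isCircuit_iff, powersetCard.mem_iff]
  rw [this, ncard_image_of_injective _ Finset.coe_injective, ← Nat.card_coe_set_eq,
    powersetCard.card, Nat.card_fin]

theorem rk_uniform_ground (hrn : r ≤ n) : rk (uniform r n) univ = r := by
  obtain ⟨J, -, hJ⟩ := exists_subset_card_eq (s := (univ : Set (Fin n))) (n := r) (by simpa)
  refine (rk_le_of_forall_indep finite_univ fun I _ hI => uniform_indep_iff.1 hI).antisymm ?_
  exact hJ.ge.trans (ncard_le_rk_of_indep (uniform_indep_iff.2 hJ.le) (subset_univ J) finite_univ)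

theorem isomorphic_uniform {N : Matroid α} (hN : N.E.Finite)
    (hindep : ∀ I ⊆ N.E, N.Indep I ↔ I.ncard ≤ r) : Isomorphic N (uniform r N.E.ncard) := by
  have := hN.to_subtype
  have e : N.E ≃ Fin N.E.ncard := Finite.equivFinOfCardEq rfl
  refine ⟨e.trans (Equiv.Set.univ _).symm, fun I => ?_⟩
  rw [hindep _ (Subtype.coe_image_subset _ _), uniform_indep_iff,
    ncard_image_of_injective _ Subtype.val_injective,
    ncard_image_of_injective _ Subtype.val_injective,
    ncard_image_of_injective _ (Equiv.injective _)]

theorem IsSimple.isomorphic_uniform_two (hM : IsSimple M) (hE : M.E.Finite) (hrk : rk M M.E ≤ 2) :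
    Isomorphic M (uniform 2 M.E.ncard) := by
  refine isomorphic_uniform hE fun I hI => ⟨fun h => ?_, fun h => ?_⟩
  · exact (ncard_le_rk_of_indep h hI hE).trans hrk
  · refine hM.indep_of_encard_le_two hI ?_
    rw [← (hE.subset hI).cast_ncard_eq]
    exact_mod_cast h

theorem IsSimple.restrict {R : Set α} (hM : IsSimple M) (hR : R ⊆ M.E) : IsSimple (M.restrict R) :=
  fun _ hC => hM ((Matroid.restrict_isCircuit_iff hR).1 hC).1

theorem isomorphic_derived_uniform_two [M.Finite] (h : nul M M.E ≤ 2) :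
    Isomorphic (derived M) (uniform 2 (circuits M).ncard) := by
  refine (isSimple_derived M).isomorphic_uniform_two (circuits_finite M) ?_
  have hground : (derived M).E = circuitsIn M M.E :=
    subset_antisymm (fun C hC => ⟨hC, Matroid.IsCircuit.subset_ground hC⟩) fun C hC => hC.1
  rw [hground]
  exact (rk_derived_circuitsIn_le M.ground_finite).trans h

theorem isomorphic_derived_uniform_two_four : Isomorphic (derived (uniform 2 4)) (uniform 2 4) := by
  have hnul : nul (uniform 2 4) univ ≤ 2 := by
    have := rk_add_nul (M := uniform 2 4) finite_univ
    rw [rk_uniform_ground (by norm_num), ncard_univ, Nat.card_fin] at this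
    lia
  have h := isomorphic_derived_uniform_two hnul
  rwa [ncard_circuits_uniform] at h

end Uniform

theorem isDirectSumOfCopies_of_isomorphic_derived [M.Finite] (h : Isomorphic (derived M) M) :
    IsDirectSumOfCopies M (uniform 2 4) := by
  obtain ⟨g, hg, hmap⟩ := h.exists_eq_map
  have hM : IsSimple M := isSimple_of_isSimple_map (hmap ▸ isSimple_derived M)
  obtain ⟨k, ⟨e⟩⟩ := Finite.exists_equiv_fin (Component M)
  let K (i : Fin k) : Component M := e.symm i
  refine ⟨k, fun i => M.restrict (K i).carrier, ?_, ?_, fun i => ?_⟩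
  · exact (Component.pairwise_disjoint_carrier M).comp_of_injective e.symm.injective
  · refine eq_disjointSigma_restrict _ ?_ fun i C hC => Component.isCircuit_subset_carrier hC
    exact (e.symm.surjective.iUnion_comp Component.carrier).trans (Component.iUnion_carrier M)
  · have hKE := (K i).carrier_subset_ground
    have hK := M.ground_finite.subset hKE
    obtain ⟨hrk, hnul⟩ := rk_carrier_eq_two_and_nul_carrier_eq_two hmap (K i)
    have hcard : (K i).carrier.ncard = 4 := by rw [← rk_add_nul hK, hrk, hnul]
    have hrestrict : rk (M.restrict (K i).carrier) (K i).carrier = 2 := by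
      rw [rk, M.restrict_eRk_eq subset_rfl, ← rk, hrk]
    exact hcard ▸ (hM.restrict hKE).isomorphic_uniform_two hK hrestrict.le

end DerivedMatroid

theorem mainTheorem1 :
    (∀ (α : Type*) (M : Matroid α) [M.Finite],
      DerivedMatroid.Isomorphic (DerivedMatroid.derived M) M →
        DerivedMatroid.IsDirectSumOfCopies M (DerivedMatroid.uniform 2 4)) ∧
    DerivedMatroid.Isomorphic (DerivedMatroid.derived (DerivedMatroid.uniform 2 4))
      (DerivedMatroid.uniform 2 4) ∧
    (∀ C : Set (Fin 4), (DerivedMatroid.uniform 2 4).IsCircuit C ↔ C.ncard = 3) :=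
  ⟨fun _ _ _ h => DerivedMatroid.isDirectSumOfCopies_of_isomorphic_derived h,
    DerivedMatroid.isomorphic_derived_uniform_two_four,
    fun _ => DerivedMatroid.uniform_isCircuit_iff⟩
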